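/- Sequences are real and indexed by the positive integers, and $|x|$ and $\le$ are understood coordinatewise. A \emph{rearrangement invariant sequence space} is a Banach space $(X,\|\cdot\|_X)$ that is a linear subspace of the space of all real sequences, contains a sequence all of whose terms are positive, and has the following two properties: (i) if $|f|\le|g|$ and $g\in X$, then $f\in X$ and $\|f\|_X\le\|g\|_X$; (ii) if $f\in X$ and $g$ is a sequence such that the sets $\{n:|f_n|>\lambda\}$ and $\{n:|g_n|>\lambda\}$ have the same number of elements (in $\{0,1,2,\dots,\infty\}$) for every $\lambda\ge0$, then $g\in X$ and $\|g\|_X=\|f\|_X$. Let $C$ be the discrete Cesàro operator, $(Cx)_n=\frac1n\sum_{k=1}^n x_k$. For a linear subspace $Y$ of the space of all real sequences with a norm satisfying (i), let $CY$ be the space of all sequences $x$ with $C(|x|)\in Y$, normed by $\|x\|_{CY}=\|C(|x|)\|_Y$. An element $x\in Y$ is \emph{order continuous} if $\|x_n\|_Y\to0$ for every non-increasing sequence $(x_n)$ in $Y$ with $0\le x_n\le|x|$ and $\inf_n x_n=0$ in $Y$. Let $Y_a$ be the subspace of all order continuous elements of $Y$, with the norm of $Y$; $Y$ is \emph{order continuous}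 if $Y=Y_a$. Let $X$ be a rearrangement invariant sequence space such that $C$ is a bounded operator from $X$ to $X$. Then $(CX)_a=C(X_a)$ (with equal norms). Moreover, $CX$ is order continuous if and only if $X$ is order continuous. -/

import Mathlib

open Filter Topology

/-- A normed ideal space of real sequences: a linear subspace of the space of all real sequences
with a norm having the ideal property. A sequence `(x₁, x₂, …)` is represented by the function
`n ↦ x₍ₙ₊₁₎` on `ℕ`, and `ℕ → ℝ` carries the coordinatewise order. -/
structure NormedIdealSeqSpace where
  carrier : Submodule ℝ (ℕ → ℝ)
  norm : Seminorm ℝ carrier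
  eq_zero_of_norm_eq_zero : ∀ x : carrier, norm x = 0 → x = 0
  ideal : ∀ (f : ℕ → ℝ) (g : carrier), (∀ n, |f n| ≤ |(g : ℕ → ℝ) n|) →
    ∃ hf : f ∈ carrier, norm ⟨f, hf⟩ ≤ norm g

namespace NormedIdealSeqSpace

/-- Every Cauchy sequence for the norm of `X` converges in norm to an element of `X`. -/
def IsBanach (X : NormedIdealSeqSpace) : Prop :=
  ∀ u : ℕ → X.carrier,
    (∀ ε : ℝ, 0 < ε → ∃ N : ℕ, ∀ m ≥ N, ∀ n ≥ N, X.norm (u m - u n) < ε) →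
    ∃ x : X.carrier, Tendsto (fun n => X.norm (u n - x)) atTop (𝓝 0)

/-- `X` contains a sequence all of whose terms are positive. -/
def HasWeakUnit (X : NormedIdealSeqSpace) : Prop :=
  ∃ w ∈ X.carrier, ∀ n, 0 < w n

/-- The distribution function of a sequence with respect to the counting measure. -/
noncomputable def distribution (f : ℕ → ℝ) (t : ℝ) : ℕ∞ :=
  {n : ℕ | t < |f n|}.encard

/-- Two sequences are equimeasurable if they have the same distribution function. -/
def Equimeasurable (f g : ℕ → ℝ) : Prop :=
  ∀ t : ℝ, 0 ≤ t → distribution f t = distribution g t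

/-- A rearrangement invariant sequence space. -/
structure IsRearrangementInvariant (X : NormedIdealSeqSpace) : Prop where
  isBanach : X.IsBanach
  hasWeakUnit : X.HasWeakUnit
  equimeasurable : ∀ (f : X.carrier) (g : ℕ → ℝ), Equimeasurable (f : ℕ → ℝ) g →
    ∃ hg : g ∈ X.carrier, X.norm ⟨g, hg⟩ = X.norm f

/-- `x` is an order continuous element of `X`: whenever `0 ≤ uₙ ≤ |x|` in `X` and `uₙ ↓ 0`
(that is, `u` is non-increasing and its infimum in `X` is `0`), then `‖uₙ‖ → 0`. -/
def IsOrderContElem (X : NormedIdealSeqSpace) (x : X.carrier) : Prop :=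
  ∀ u : ℕ → X.carrier, (∀ n, 0 ≤ u n) → (∀ n, (u n : ℕ → ℝ) ≤ |(x : ℕ → ℝ)|) →
    Antitone u → IsGLB (Set.range u) 0 →
    Tendsto (fun n => X.norm (u n)) atTop (𝓝 0)

/-- `X` is order continuous if all of its elements are. -/
def IsOrderContinuous (X : NormedIdealSeqSpace) : Prop :=
  ∀ x : X.carrier, X.IsOrderContElem x

theorem IsOrderContElem.of_abs_le {X : NormedIdealSeqSpace} {x y : X.carrier}
    (hx : X.IsOrderContElem x) (h : |(y : ℕ → ℝ)| ≤ |(x : ℕ → ℝ)|) : X.IsOrderContElem y :=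
  fun u h0 hu ha hi => hx u h0 (fun n => (hu n).trans h) ha hi

theorem isOrderContElem_zero (X : NormedIdealSeqSpace) : X.IsOrderContElem 0 := by
  intro u h0 hu _ _
  have : ∀ n, u n = 0 := fun n => le_antisymm
    (show (u n : ℕ → ℝ) ≤ 0 by simpa using hu n) (h0 n)
  simp [this]

theorem mem_of_abs_le (X : NormedIdealSeqSpace) {f : ℕ → ℝ} (g : X.carrier)
    (h : ∀ n, |f n| ≤ |(g : ℕ → ℝ) n|) : f ∈ X.carrier := (X.ideal f g h).1

theorem norm_le_of_abs_le (X : NormedIdealSeqSpace) (f g : X.carrier)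
    (h : ∀ n, |(f : ℕ → ℝ) n| ≤ |(g : ℕ → ℝ) n|) : X.norm f ≤ X.norm g := (X.ideal f g h).2

theorem IsOrderContElem.smul {X : NormedIdealSeqSpace} {x : X.carrier}
    (hx : X.IsOrderContElem x) (c : ℝ) : X.IsOrderContElem (c • x) := by
  by_cases hc : c = 0
  · subst hc
    simpa using X.isOrderContElem_zero
  intro u h0 hu ha hi
  have hc' : 0 < |c| := abs_pos.mpr hc
  have key := hx (fun n => |c|⁻¹ • u n)
    (fun n i => by
      have := h0 n i
      simp only [Submodule.coe_zero, Pi.zero_apply, Submodule.coe_smul, Pi.smul_apply,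
        smul_eq_mul] at this ⊢
      positivity)
    (fun n i => by
      have := hu n i
      simp only [Submodule.coe_smul, Pi.smul_apply, Pi.abs_apply, smul_eq_mul, abs_mul] at this ⊢
      rw [inv_mul_le_iff₀ hc']
      exact this)
    (fun m n hmn i => by
      have := ha hmn i
      simp only [Submodule.coe_smul, Pi.smul_apply, smul_eq_mul]
      exact mul_le_mul_of_nonneg_left this (by positivity))
    ⟨by
      rintro _ ⟨n, rfl⟩ i
      have := h0 n i
      simp only [Submodule.coe_zero, Pi.zero_apply, Submodule.coe_smul, Pi.smul_apply,
        smul_eq_mul] at this ⊢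
      positivity, by
      intro w hw
      have h1 : |c| • w ≤ 0 := hi.2 (by
        rintro _ ⟨n, rfl⟩ i
        have := hw ⟨n, rfl⟩ i
        simp only [Submodule.coe_smul, Pi.smul_apply, smul_eq_mul] at this ⊢
        rwa [← div_eq_inv_mul, le_div_iff₀' hc'] at this)
      intro i
      have := h1 i
      simp only [Submodule.coe_zero, Pi.zero_apply, Submodule.coe_smul, Pi.smul_apply,
        smul_eq_mul] at this ⊢
      by_contra hneg
      push Not at hneg
      have := mul_pos hc' hneg
      linarith⟩
  have h2 := key.const_mul |c|
  simp only [map_smul_eq_mul, mul_zero] at h2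
  refine h2.congr fun n => ?_
  simp [hc]

theorem IsOrderContElem.add {X : NormedIdealSeqSpace} {x y : X.carrier}
    (hx : X.IsOrderContElem x) (hy : X.IsOrderContElem y) : X.IsOrderContElem (x + y) := by
  intro u h0 hu ha hi
  have h0' : ∀ n i, 0 ≤ (u n : ℕ → ℝ) i := fun n i => h0 n i
  have ha' : ∀ {m n}, m ≤ n → ∀ i, (u n : ℕ → ℝ) i ≤ (u m : ℕ → ℝ) i := fun h i => ha h i
  let v : ℕ → X.carrier := fun n =>
    ⟨fun i => min ((u n : ℕ → ℝ) i) |(x : ℕ → ℝ) i|, X.mem_of_abs_le (u n) fun i => by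
      rw [abs_of_nonneg (le_min (h0' n i) (abs_nonneg _)), abs_of_nonneg (h0' n i)]
      exact min_le_left _ _⟩
  let w : ℕ → X.carrier := fun n => u n - v n
  have hv0 : ∀ n, 0 ≤ v n := fun n i => le_min (h0' n i) (abs_nonneg _)
  have hvu : ∀ n, v n ≤ u n := fun n i => min_le_left _ _
  have hw0 : ∀ n, 0 ≤ w n := fun n i => sub_nonneg.mpr (hvu n i)
  have hwu : ∀ n, w n ≤ u n := fun n i => sub_le_self _ (hv0 n i)
  have glb : ∀ z : ℕ → X.carrier, (∀ n, 0 ≤ z n) → (∀ n, z n ≤ u n) →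
      IsGLB (Set.range z) 0 := by
    intro z hz0 hzu
    refine ⟨by rintro _ ⟨n, rfl⟩; exact hz0 n, fun b hb => hi.2 ?_⟩
    rintro _ ⟨n, rfl⟩
    exact (hb ⟨n, rfl⟩).trans (hzu n)
  have hv := hx v hv0 (fun n i => min_le_right _ _)
    (fun m n h i => min_le_min_right _ (ha' h i)) (glb v hv0 hvu)
  have hw := hy w hw0
    (fun n i => by
      have h1 : (u n : ℕ → ℝ) i ≤ |(x : ℕ → ℝ) i + (y : ℕ → ℝ) i| := hu n i
      have h2 := abs_add_le ((x : ℕ → ℝ) i) ((y : ℕ → ℝ) i)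
      change (u n : ℕ → ℝ) i - min ((u n : ℕ → ℝ) i) |(x : ℕ → ℝ) i| ≤ |(y : ℕ → ℝ) i|
      have h3 := abs_nonneg ((y : ℕ → ℝ) i)
      rcases min_cases ((u n : ℕ → ℝ) i) |(x : ℕ → ℝ) i| with h | h <;> linarith [h.1])
    (fun m n h i => by
      have h1 := ha' h i
      change (u n : ℕ → ℝ) i - min ((u n : ℕ → ℝ) i) |(x : ℕ → ℝ) i| ≤
        (u m : ℕ → ℝ) i - min ((u m : ℕ → ℝ) i) |(x : ℕ → ℝ) i|
      rcases min_cases ((u n : ℕ → ℝ) i) |(x : ℕ → ℝ) i| with h | h <;>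
      rcases min_cases ((u m : ℕ → ℝ) i) |(x : ℕ → ℝ) i| with h' | h' <;>
      linarith [h.1, h.2, h'.1, h'.2])
    (glb w hw0 hwu)
  have hvw := hv.add hw
  rw [add_zero] at hvw
  refine squeeze_zero (fun n => apply_nonneg _ _) (fun n => ?_) hvw
  calc X.norm (u n) = X.norm (v n + w n) := by simp [w]
    _ ≤ _ := map_add_le_add _ _ _

/-- The ideal `X_a` of order continuous elements of `X`, with the norm of `X`. -/
def orderContPart (X : NormedIdealSeqSpace) : NormedIdealSeqSpace where
  carrier :=
    { carrier := {f | ∃ hf : f ∈ X.carrier, X.IsOrderContElem ⟨f, hf⟩}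
      add_mem' := by
        rintro f g ⟨hf, hf'⟩ ⟨hg, hg'⟩
        exact ⟨X.carrier.add_mem hf hg, hf'.add hg'⟩
      zero_mem' := ⟨X.carrier.zero_mem, X.isOrderContElem_zero⟩
      smul_mem' := by
        rintro c f ⟨hf, hf'⟩
        exact ⟨X.carrier.smul_mem c hf, hf'.smul c⟩ }
  norm := X.norm.comp (Submodule.inclusion fun _ hf => hf.1)
  eq_zero_of_norm_eq_zero := fun x hx => by
    have h := congrArg Subtype.val (X.eq_zero_of_norm_eq_zero ⟨(x : ℕ → ℝ), x.2.1⟩ hx)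
    exact Subtype.ext h
  ideal := by
    rintro f ⟨g, hg, hg'⟩ h
    obtain ⟨hf, hfn⟩ := X.ideal f ⟨g, hg⟩ h
    exact ⟨⟨hf, hg'.of_abs_le h⟩, hfn⟩

/-- The discrete Cesàro operator `(Cx)ₙ = (x₁ + ⋯ + xₙ) / n` (for `n ≥ 1`), in the indexing of
sequences by `ℕ`. -/
noncomputable def cesaroOp (f : ℕ → ℝ) : ℕ → ℝ :=
  fun n => (1 / ((n : ℝ) + 1)) * ∑ k ∈ Finset.range (n + 1), f k

/-- The discrete Cesàro operator maps `X` to `X` and is bounded. -/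
def CesaroBounded (X : NormedIdealSeqSpace) : Prop :=
  ∃ M : ℝ, ∀ f : X.carrier, ∃ h : cesaroOp (f : ℕ → ℝ) ∈ X.carrier,
    X.norm ⟨cesaroOp (f : ℕ → ℝ), h⟩ ≤ M * X.norm f

theorem cesaroOp_abs_nonneg (f : ℕ → ℝ) (n : ℕ) : 0 ≤ cesaroOp |f| n :=
  mul_nonneg (by positivity) (Finset.sum_nonneg fun _ _ => abs_nonneg _)

theorem cesaroOp_add (f g : ℕ → ℝ) : cesaroOp (f + g) = cesaroOp f + cesaroOp g := by
  ext n
  simp [cesaroOp, Finset.sum_add_distrib, mul_add]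

theorem cesaroOp_smul (c : ℝ) (f : ℕ → ℝ) : cesaroOp (c • f) = c • cesaroOp f := by
  ext n
  simp only [cesaroOp, Pi.smul_apply, smul_eq_mul, ← Finset.mul_sum]
  ring

theorem cesaroOp_mono {f g : ℕ → ℝ} (h : f ≤ g) : cesaroOp f ≤ cesaroOp g := fun _ =>
  mul_le_mul_of_nonneg_left (Finset.sum_le_sum fun i _ => h i) (by positivity)

theorem cesaroOp_abs_le {f g : ℕ → ℝ} (h : |f| ≤ g) (n : ℕ) :
    |cesaroOp |f| n| ≤ |cesaroOp g n| := by
  rw [abs_of_nonneg (cesaroOp_abs_nonneg f n)]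
  exact (cesaroOp_mono h n).trans (le_abs_self _)

theorem cesaroOp_abs_smul (c : ℝ) (f : ℕ → ℝ) :
    cesaroOp |c • f| = |c| • cesaroOp |f| := by
  rw [← cesaroOp_smul]
  congr 1
  ext n
  simp [abs_mul]

theorem cesaroOp_abs_add_le (f g : ℕ → ℝ) (n : ℕ) :
    |cesaroOp |f + g| n| ≤ |(cesaroOp |f| + cesaroOp |g|) n| := by
  rw [← cesaroOp_add]
  exact cesaroOp_abs_le (fun i => abs_add_le _ _) n

/-- The abstract Cesàro sequence space `CX`: the sequences `x` with `C(|x|) ∈ X`, normed by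
`‖x‖ = ‖C(|x|)‖_X`. -/
noncomputable def cesaroSpace (X : NormedIdealSeqSpace) : NormedIdealSeqSpace where
  carrier :=
    { carrier := {f | cesaroOp |f| ∈ X.carrier}
      add_mem' := by
        intro f g hf hg
        exact X.mem_of_abs_le ⟨_, X.carrier.add_mem hf hg⟩ (cesaroOp_abs_add_le f g)
      zero_mem' := by
        have : cesaroOp |(0 : ℕ → ℝ)| = 0 := by ext n; simp [cesaroOp]
        change cesaroOp |(0 : ℕ → ℝ)| ∈ X.carrier
        rw [this]
        exact X.carrier.zero_mem
      smul_mem' := by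
        intro c f hf
        change cesaroOp |c • f| ∈ X.carrier
        rw [cesaroOp_abs_smul]
        exact X.carrier.smul_mem _ hf }
  norm := Seminorm.of (fun x => X.norm ⟨cesaroOp |(x : ℕ → ℝ)|, x.2⟩)
    (fun x y => (X.norm_le_of_abs_le _ (⟨_, x.2⟩ + ⟨_, y.2⟩)
      (cesaroOp_abs_add_le x y)).trans (map_add_le_add _ _ _))
    (fun c x => by
      have h := map_smul_eq_mul X.norm |c| ⟨cesaroOp |(x : ℕ → ℝ)|, x.2⟩
      rw [norm_abs_eq_norm] at h
      rw [← h]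
      congr 1
      exact Subtype.ext (cesaroOp_abs_smul c x))
  eq_zero_of_norm_eq_zero := by
    intro x hx
    have h := congrArg Subtype.val
      (X.eq_zero_of_norm_eq_zero ⟨cesaroOp |(x : ℕ → ℝ)|, x.2⟩ hx)
    ext n
    have hn : (1 / ((n : ℝ) + 1)) * ∑ k ∈ Finset.range (n + 1), |(x : ℕ → ℝ) k| = 0 :=
      congrFun h n
    have hs : ∑ k ∈ Finset.range (n + 1), |(x : ℕ → ℝ) k| = 0 :=
      (mul_eq_zero.mp hn).resolve_left (by positivity)
    exact abs_eq_zero.mp ((Finset.sum_eq_zero_iff_of_nonneg fun _ _ => abs_nonneg _).mp hs n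
      (Finset.self_mem_range_succ n))
  ideal := by
    intro f g h
    exact X.ideal (cesaroOp |f|) ⟨cesaroOp |(g : ℕ → ℝ)|, g.2⟩ (cesaroOp_abs_le h)

end NormedIdealSeqSpace

namespace NormedIdealSeqSpace

/-! In any normed ideal sequence space, order continuity of `x` amounts to the norms of its tails
tending to `0`. So `(CX)_a = C(X_a)` reduces to comparing tails of `x` in `CX` with tails of `C|x|`
in `X`. Splitting `x` at `N` bounds `C|x|` by `C` of the tail plus a multiple of `h = (1/(k+1))`.
The point is that `h` is order continuous in `X`: `Ch` exceeds `h` by the divergent harmonic factor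
(`exists_reciprocal_tendsto_tail`). The reverse inclusion holds because `C` preserves decreasing
coordinatewise limits.

If `CX` is order continuous, a non-increasing nonnegative `y` in `X` satisfies `y ≤ Cy`, hence is
order continuous. Rearrangement invariance carries this over to an arbitrary `x`: first `x` is null
(`tendsto_zero_of_mem`), so its non-increasing rearrangement exists, and tails of `x` are controlled
by truncations of that rearrangement. -/

theorem norm_nonneg' (X : NormedIdealSeqSpace) (x : X.carrier) : 0 ≤ X.norm x := apply_nonneg _ _

theorem ext_of_norm {X Y : NormedIdealSeqSpace} (h : ∀ f, f ∈ X.carrier ↔ f ∈ Y.carrier)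
    (hn : ∀ f (hf : f ∈ X.carrier) (hf' : f ∈ Y.carrier), X.norm ⟨f, hf⟩ = Y.norm ⟨f, hf'⟩) :
    X = Y := by
  obtain ⟨A, p, _, _⟩ := X
  obtain ⟨B, q, _, _⟩ := Y
  obtain rfl : A = B := Submodule.ext h
  obtain rfl : p = q := Seminorm.ext fun x => hn x x.2 x.2
  rfl

/-! ### Order continuity through tails. -/

/-- If `a` is the limit at coordinate `i`, the sequence equal to `a` at `i` and `0` elsewhere lies
in `X` by solidity and is a lower bound, so `a ≤ 0`. -/
theorem tendsto_apply_of_isGLB {X : NormedIdealSeqSpace} {u : ℕ → X.carrier}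
    (h0 : ∀ n, 0 ≤ u n) (ha : Antitone u) (hi : IsGLB (Set.range u) 0) (i : ℕ) :
    Tendsto (fun n => (u n : ℕ → ℝ) i) atTop (𝓝 0) := by
  have h0' : ∀ n i, 0 ≤ (u n : ℕ → ℝ) i := fun n i => h0 n i
  have hbdd : BddBelow (Set.range fun n => (u n : ℕ → ℝ) i) :=
    ⟨0, by rintro _ ⟨n, rfl⟩; exact h0' n i⟩
  have hlim := tendsto_atTop_ciInf (f := fun n => (u n : ℕ → ℝ) i) (fun m n h => ha h i) hbdd
  set a := ⨅ n, (u n : ℕ → ℝ) i with ha_def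
  have ha0 : 0 ≤ a := le_ciInf fun n => h0' n i
  have hle : ∀ n j, (Pi.single i a : ℕ → ℝ) j ≤ (u n : ℕ → ℝ) j := by
    intro n j
    rcases eq_or_ne j i with rfl | hj
    · simpa using ciInf_le hbdd n
    · simpa [hj] using h0' n j
  have hnn : ∀ j, 0 ≤ (Pi.single i a : ℕ → ℝ) j := fun j =>
    (Pi.single_nonneg.mpr ha0 : (0 : ℕ → ℝ) ≤ Pi.single i a) j
  have hmem : Pi.single i a ∈ X.carrier := X.mem_of_abs_le (u 0) fun j => by
    rw [abs_of_nonneg (hnn j), abs_of_nonneg (h0' 0 j)]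
    exact hle 0 j
  have hz : (⟨Pi.single i a, hmem⟩ : X.carrier) ≤ 0 := hi.2 (by
    rintro _ ⟨n, rfl⟩
    exact hle n)
  have : a ≤ 0 := by simpa using hz i
  rwa [le_antisymm this ha0] at hlim

theorem isGLB_of_tendsto_apply {X : NormedIdealSeqSpace} {u : ℕ → X.carrier}
    (h0 : ∀ n, 0 ≤ u n) (h : ∀ i, Tendsto (fun n => (u n : ℕ → ℝ) i) atTop (𝓝 0)) :
    IsGLB (Set.range u) 0 :=
  ⟨by rintro _ ⟨n, rfl⟩; exact h0 n, fun b hb i =>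
    ge_of_tendsto' (h i) fun n => hb ⟨n, rfl⟩ i⟩

theorem abs_indicator_le_abs (s : Set ℕ) (x : ℕ → ℝ) (i : ℕ) : |s.indicator x i| ≤ |x i| := by
  by_cases h : i ∈ s <;> simp [h]

/-- The sequence `x` with its first `N` terms replaced by `0`. -/
noncomputable def tail (X : NormedIdealSeqSpace) (x : X.carrier) (N : ℕ) : X.carrier :=
  ⟨(Set.Ici N).indicator (x : ℕ → ℝ), X.mem_of_abs_le x (abs_indicator_le_abs _ _)⟩

theorem coe_tail (X : NormedIdealSeqSpace) (x : X.carrier) (N i : ℕ) :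
    (X.tail x N : ℕ → ℝ) i = if N ≤ i then (x : ℕ → ℝ) i else 0 := by
  simp [tail, Set.indicator_apply]

theorem IsOrderContElem.tendsto_tail {X : NormedIdealSeqSpace} {x : X.carrier}
    (hx : X.IsOrderContElem x) : Tendsto (fun N => X.norm (X.tail x N)) atTop (𝓝 0) := by
  let y : X.carrier := ⟨|(x : ℕ → ℝ)|, X.mem_of_abs_le x fun n => by simp⟩
  have hy : ∀ i, (y : ℕ → ℝ) i = |(x : ℕ → ℝ) i| := fun i => rfl
  have h0 : ∀ N, 0 ≤ X.tail y N := fun N i => by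
    change 0 ≤ (X.tail y N : ℕ → ℝ) i
    rw [coe_tail, hy]
    split_ifs <;> positivity
  have key := hx (X.tail y) h0
    (fun N i => by
      rw [coe_tail, hy]
      split_ifs
      · exact le_rfl
      · exact abs_nonneg _)
    (fun M N h i => by
      change (X.tail y N : ℕ → ℝ) i ≤ (X.tail y M : ℕ → ℝ) i
      rw [coe_tail, coe_tail, hy]
      split_ifs
      · exact le_rfl
      · omega
      · exact abs_nonneg _
      · exact le_rfl)
    (isGLB_of_tendsto_apply h0 fun i => by
      refine tendsto_const_nhds.congr' ?_
      filter_upwards [eventually_gt_atTop i] with N hN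
      rw [coe_tail, if_neg (by omega)])
  refine squeeze_zero (fun _ => X.norm_nonneg' _) (fun N => ?_) key
  refine X.norm_le_of_abs_le _ _ fun i => ?_
  rw [coe_tail, coe_tail, hy]
  split_ifs <;> simp

/-- Beyond `N`, `u n` is dominated by the tail of `|x|`; on the finitely many coordinates below `N`
it is at most a null multiple of `|x|`. -/
theorem isOrderContElem_of_tail {X : NormedIdealSeqSpace} {x : X.carrier}
    (hx : ∀ ε > 0, ∃ N, X.norm (X.tail x N) ≤ ε) : X.IsOrderContElem x := by
  intro u h0 hu ha hi
  have h0' : ∀ n i, 0 ≤ (u n : ℕ → ℝ) i := fun n i => h0 n i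
  have hu' : ∀ n i, (u n : ℕ → ℝ) i ≤ |(x : ℕ → ℝ) i| := fun n i => hu n i
  have hlim := tendsto_apply_of_isGLB h0 ha hi
  rw [Metric.tendsto_atTop']
  intro ε hε
  obtain ⟨N, hN⟩ := hx (ε / 2) (by positivity)
  -- Where `x i = 0` the quotient is `0` by convention; this is harmless, since `u n` vanishes there
  -- too.
  let c : ℕ → ℝ := fun n => ∑ i ∈ Finset.range N, (u n : ℕ → ℝ) i / |(x : ℕ → ℝ) i|
  have hc0 : ∀ n, 0 ≤ c n := fun n =>
    Finset.sum_nonneg fun i _ => div_nonneg (h0' n i) (abs_nonneg _)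
  have hc : Tendsto (fun n => c n * X.norm x) atTop (𝓝 0) := by
    have : Tendsto c atTop (𝓝 0) := by
      simpa using tendsto_finsetSum (Finset.range N) fun i _ =>
        (hlim i).div_const |(x : ℕ → ℝ) i|
    simpa using this.mul_const (X.norm x)
  obtain ⟨K, hK⟩ := eventually_atTop.mp (hc.eventually_lt_const (half_pos hε))
  refine ⟨K, fun n hn => ?_⟩
  let y : X.carrier := ⟨|(x : ℕ → ℝ)|, X.mem_of_abs_le x fun n => by simp⟩
  have hy : ∀ i, (y : ℕ → ℝ) i = |(x : ℕ → ℝ) i| := fun i => rfl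
  have hyx : X.norm y ≤ X.norm x := X.norm_le_of_abs_le _ _ fun i => by simp [hy]
  have hyt : X.norm (X.tail y N) ≤ X.norm (X.tail x N) := X.norm_le_of_abs_le _ _ fun i => by
    rw [coe_tail, coe_tail, hy]
    split_ifs <;> simp
  have hle : X.norm (u n) ≤ X.norm (c n • y + X.tail y N) := by
    refine X.norm_le_of_abs_le _ _ fun i => ?_
    rw [abs_of_nonneg (h0' n i)]
    refine le_trans ?_ (le_abs_self _)
    change (u n : ℕ → ℝ) i ≤ c n * |(x : ℕ → ℝ) i| + (X.tail y N : ℕ → ℝ) i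
    rw [coe_tail, hy]
    split_ifs with h
    · have := mul_nonneg (hc0 n) (abs_nonneg ((x : ℕ → ℝ) i))
      linarith [hu' n i]
    · rcases eq_or_ne ((x : ℕ → ℝ) i) 0 with hz | hz
      · have := hu' n i
        simp only [hz, abs_zero] at this ⊢
        linarith
      · have h1 : (u n : ℕ → ℝ) i / |(x : ℕ → ℝ) i| ≤ c n :=
          Finset.single_le_sum (f := fun i => (u n : ℕ → ℝ) i / |(x : ℕ → ℝ) i|)
            (fun j _ => div_nonneg (h0' n j) (abs_nonneg _)) (Finset.mem_range.mpr (by omega))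
        rw [div_le_iff₀ (abs_pos.mpr hz)] at h1
        linarith
  have h2 : X.norm (c n • y + X.tail y N) ≤ c n * X.norm y + X.norm (X.tail y N) := by
    refine (map_add_le_add _ _ _).trans_eq ?_
    rw [map_smul_eq_mul, Real.norm_of_nonneg (hc0 n)]
  have h3 := mul_le_mul_of_nonneg_left hyx (hc0 n)
  rw [Real.dist_eq, sub_zero, abs_of_nonneg (X.norm_nonneg' _)]
  linarith [hK n hn.le]

/-! ### The identity `(CX)_a = C(X_a)`. -/

/-- The first `N` terms add at most their total mass to every partial sum, so their share of the
average is a multiple of `1/(k+1)`. -/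
theorem cesaroOp_abs_le_tail_add (f : ℕ → ℝ) (N k : ℕ) :
    cesaroOp |f| k ≤ cesaroOp |(Set.Ici N).indicator f| k +
      (∑ i ∈ Finset.range N, |f i|) * (1 / ((k : ℝ) + 1)) := by
  have h : ∑ i ∈ Finset.range (k + 1), |f i| ≤
      ∑ i ∈ Finset.range (k + 1), |(Set.Ici N).indicator f i| + ∑ i ∈ Finset.range N, |f i| := by
    have h1 : ∀ i, |f i| = |(Set.Ici N).indicator f i| + (if i < N then |f i| else 0) := by
      intro i
      by_cases hi : i < N
      · simp [hi]
      · simp [hi, not_lt.mp hi]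
    rw [Finset.sum_congr rfl fun i _ => h1 i, Finset.sum_add_distrib, ← Finset.sum_filter]
    gcongr
    exact fun i hi => Finset.mem_range.mpr (Finset.mem_filter.mp hi).2
  have := mul_le_mul_of_nonneg_left h (show (0 : ℝ) ≤ 1 / ((k : ℝ) + 1) by positivity)
  simp only [cesaroOp, Pi.abs_apply]
  linarith

/-- Here `h = C e` for the first unit vector `e`, and `g = C h` has terms `H (k + 1) / (k + 1)` with
`H` the harmonic sums. For `k ≥ n` this gives `h ≤ g / H n`, so the tail of `h` has norm at most
`‖g‖ / H n`, which tends to `0`. -/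
theorem exists_reciprocal_tendsto_tail {X : NormedIdealSeqSpace} (hw : X.HasWeakUnit)
    (hC : X.CesaroBounded) :
    ∃ h : X.carrier, (∀ k, (h : ℕ → ℝ) k = 1 / ((k : ℝ) + 1)) ∧
      Tendsto (fun N => X.norm (X.tail h N)) atTop (𝓝 0) := by
  obtain ⟨w, hw, hpos⟩ := hw
  obtain ⟨M, hM⟩ := hC
  have he : Pi.single 0 1 ∈ X.carrier :=
    X.mem_of_abs_le ((w 0)⁻¹ • ⟨w, hw⟩) fun n => by
      rcases eq_or_ne n 0 with rfl | hn
      · simp [(hpos 0).ne']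
      · simpa [hn] using mul_nonneg (inv_nonneg.mpr (abs_nonneg (w 0))) (abs_nonneg (w n))
  have hCe : ∀ k, cesaroOp (Pi.single 0 1) k = 1 / ((k : ℝ) + 1) := by
    intro k
    simp [cesaroOp]
  obtain ⟨hh, -⟩ := hM ⟨_, he⟩
  let h : X.carrier := ⟨_, hh⟩
  have hk : ∀ k, (h : ℕ → ℝ) k = 1 / ((k : ℝ) + 1) := hCe
  obtain ⟨hg, -⟩ := hM h
  let g : X.carrier := ⟨_, hg⟩
  refine ⟨h, hk, ?_⟩
  let H : ℕ → ℝ := fun n => ∑ i ∈ Finset.range n, 1 / ((i : ℝ) + 1)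
  have hH : Tendsto H atTop atTop := Real.tendsto_sum_range_one_div_nat_succ_atTop
  have hlim : Tendsto (fun n => (H n)⁻¹ * X.norm g) atTop (𝓝 0) := by
    simpa using hH.inv_tendsto_atTop.mul_const (X.norm g)
  refine squeeze_zero' (Eventually.of_forall fun _ => X.norm_nonneg' _) ?_ hlim
  filter_upwards [hH.eventually_gt_atTop 0] with n hn
  have : X.norm (X.tail h n) ≤ X.norm ((H n)⁻¹ • g) := by
    refine X.norm_le_of_abs_le _ _ fun k => ?_
    rw [coe_tail]
    split_ifs with hnk
    · refine le_trans ?_ (le_abs_self _)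
      have hgk : (g : ℕ → ℝ) k = 1 / ((k : ℝ) + 1) * H (k + 1) := by
        change (1 / ((k : ℝ) + 1)) * ∑ i ∈ Finset.range (k + 1), (h : ℕ → ℝ) i = _
        simp only [hk, H]
      have hmono : H n ≤ H (k + 1) := Finset.sum_le_sum_of_subset_of_nonneg
        (Finset.range_subset_range.mpr (by omega)) fun i _ _ => by positivity
      change _ ≤ (H n)⁻¹ * (g : ℕ → ℝ) k
      rw [hk, hgk, abs_of_nonneg (by positivity), ← div_eq_inv_mul, le_div_iff₀ hn]
      gcongr
    · rw [abs_zero]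
      exact abs_nonneg _
  rwa [map_smul_eq_mul, Real.norm_of_nonneg (inv_nonneg.mpr hn.le)] at this

theorem IsOrderContElem.cesaroOp_abs {X : NormedIdealSeqSpace} (hw : X.HasWeakUnit)
    (hC : X.CesaroBounded) {x : X.cesaroSpace.carrier} (hx : X.cesaroSpace.IsOrderContElem x) :
    X.IsOrderContElem ⟨cesaroOp |(x : ℕ → ℝ)|, x.2⟩ := by
  obtain ⟨h, hk, hh⟩ := exists_reciprocal_tendsto_tail hw hC
  refine isOrderContElem_of_tail fun ε hε => ?_
  obtain ⟨N, hN⟩ := (hx.tendsto_tail.eventually_lt_const (half_pos hε)).exists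
  let t : X.carrier := ⟨cesaroOp |(X.cesaroSpace.tail x N : ℕ → ℝ)|, (X.cesaroSpace.tail x N).2⟩
  -- The norm of `CX` at a tail is by definition the `X`-norm of its Cesàro image.
  have ht : X.norm t < ε / 2 := hN
  set S := ∑ i ∈ Finset.range N, |(x : ℕ → ℝ) i| with hS
  have hS0 : 0 ≤ S := Finset.sum_nonneg fun _ _ => abs_nonneg _
  have hlim : Tendsto (fun n => S * X.norm (X.tail h n)) atTop (𝓝 0) := by
    simpa using hh.const_mul S
  obtain ⟨M, hM⟩ := (hlim.eventually_lt_const (half_pos hε)).exists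
  refine ⟨M, ?_⟩
  have hle : X.norm (X.tail ⟨cesaroOp |(x : ℕ → ℝ)|, x.2⟩ M) ≤ X.norm (t + S • X.tail h M) := by
    refine X.norm_le_of_abs_le _ _ fun k => ?_
    rw [coe_tail]
    split_ifs with hMk
    · refine le_trans ?_ (le_abs_self _)
      rw [abs_of_nonneg (cesaroOp_abs_nonneg _ _)]
      change _ ≤ (t : ℕ → ℝ) k + S * (X.tail h M : ℕ → ℝ) k
      rw [coe_tail, if_pos hMk, hk]
      exact cesaroOp_abs_le_tail_add _ N k
    · simp
  have h2 : X.norm (t + S • X.tail h M) ≤ X.norm t + S * X.norm (X.tail h M) := by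
    refine (map_add_le_add _ _ _).trans_eq ?_
    rw [map_smul_eq_mul, Real.norm_of_nonneg hS0]
  linarith

/-- Each coordinate of `C (u n)` is a finite average, so `u n ↓ 0` coordinatewise forces `C (u n) ↓
0` below `C|x|`. -/
theorem IsOrderContElem.of_cesaroOp_abs {X : NormedIdealSeqSpace} {x : X.cesaroSpace.carrier}
    (hx : X.IsOrderContElem ⟨cesaroOp |(x : ℕ → ℝ)|, x.2⟩) : X.cesaroSpace.IsOrderContElem x := by
  intro u h0 hu ha hi
  have habs : ∀ n, |(u n : ℕ → ℝ)| = u n := fun n => abs_of_nonneg (h0 n)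
  have hlim := tendsto_apply_of_isGLB h0 ha hi
  have hnn : ∀ n, (0 : X.carrier) ≤ ⟨cesaroOp |(u n : ℕ → ℝ)|, (u n).2⟩ :=
    fun n i => cesaroOp_abs_nonneg _ i
  refine hx (fun n => ⟨cesaroOp |(u n : ℕ → ℝ)|, (u n).2⟩) hnn (fun n i => ?_) (fun m n h => ?_)
    (isGLB_of_tendsto_apply hnn fun i => ?_)
  · refine le_trans (cesaroOp_mono ?_ i) (le_abs_self _)
    rw [habs]
    exact hu n
  · refine cesaroOp_mono (f := |(u n : ℕ → ℝ)|) (g := |(u m : ℕ → ℝ)|) ?_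
    rw [habs, habs]
    exact ha h
  · simp only [habs]
    simpa [cesaroOp] using (tendsto_finsetSum (Finset.range (i + 1)) fun k _ => hlim k).const_mul
      (1 / ((i : ℝ) + 1))

theorem orderContPart_cesaroSpace {X : NormedIdealSeqSpace} (hw : X.HasWeakUnit)
    (hC : X.CesaroBounded) : X.cesaroSpace.orderContPart = X.orderContPart.cesaroSpace := by
  refine ext_of_norm (fun f => ⟨?_, ?_⟩) fun f _ _ => rfl
  · rintro ⟨hf, h⟩
    exact ⟨hf, h.cesaroOp_abs hw hC⟩
  · rintro ⟨hf, h⟩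
    exact ⟨hf, IsOrderContElem.of_cesaroOp_abs (x := ⟨f, hf⟩) h⟩

theorem IsOrderContinuous.cesaroSpace {X : NormedIdealSeqSpace} (hX : X.IsOrderContinuous) :
    X.cesaroSpace.IsOrderContinuous := fun _ => IsOrderContElem.of_cesaroOp_abs (hX _)

/-! ### Non-increasing rearrangements of null sequences. -/

/-- The non-increasing rearrangement of a sequence. -/
noncomputable def rearrangement (f : ℕ → ℝ) (k : ℕ) : ℝ :=
  sInf {t : ℝ | 0 ≤ t ∧ distribution f t ≤ k}

theorem rearrangement_nonneg (f : ℕ → ℝ) (k : ℕ) : 0 ≤ rearrangement f k :=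
  Real.sInf_nonneg fun _ h => h.1

theorem rearrangement_set_nonempty {f : ℕ → ℝ} (hf : Tendsto f atTop (𝓝 0)) (k : ℕ) :
    {t : ℝ | 0 ≤ t ∧ distribution f t ≤ k}.Nonempty := by
  obtain ⟨B, hB⟩ := hf.abs.bddAbove_range
  have hB' : ∀ n, |f n| ≤ B := fun n => hB ⟨n, rfl⟩
  refine ⟨B, (abs_nonneg _).trans (hB' 0), ?_⟩
  have : {n : ℕ | B < |f n|} = ∅ := Set.eq_empty_of_forall_notMem fun n hn =>
    absurd (hB' n) (not_le.mpr hn)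
  simp [distribution, this]

/-- For the reverse direction, choose `k + 1` indices with `|f| > t`. The least value of `|f|` on
them is attained, hence still exceeds `t`, and no level below it is exceeded at most `k` times. -/
theorem lt_rearrangement_iff {f : ℕ → ℝ} (hf : Tendsto f atTop (𝓝 0)) {t : ℝ} (ht : 0 ≤ t)
    (k : ℕ) : t < rearrangement f k ↔ (k : ℕ∞) < distribution f t := by
  constructor
  · intro h
    by_contra hcon
    exact not_le.mpr h (csInf_le ⟨0, fun _ h => h.1⟩ ⟨ht, not_lt.mp hcon⟩)
  · intro h
    have h' : ((k + 1 : ℕ) : ℕ∞) ≤ {n : ℕ | t < |f n|}.encard := by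
      push_cast
      exact Order.add_one_le_of_lt h
    obtain ⟨s, hs, hcard⟩ := Set.exists_subset_encard_eq h'
    have hfin : s.Finite := Set.finite_of_encard_eq_coe hcard
    have hne : s.Nonempty := by
      rw [← Set.encard_ne_zero, hcard]
      simp
    obtain ⟨m, hm, hmin⟩ := Set.exists_min_image s (fun n => |f n|) hfin hne
    refine (hs hm : t < |f m|).trans_le (le_csInf (rearrangement_set_nonempty hf k) ?_)
    rintro r ⟨-, hr⟩
    by_contra hlt
    have hsub : s ⊆ {n : ℕ | r < |f n|} := fun n hn => (not_le.mp hlt).trans_le (hmin n hn)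
    have h1 := (Set.encard_le_encard hsub).trans hr
    rw [hcard] at h1
    have : k + 1 ≤ k := by exact_mod_cast h1
    omega

theorem encard_setOf_natCast_lt (d : ℕ∞) : {k : ℕ | (k : ℕ∞) < d}.encard = d := by
  induction d with
  | top => simp
  | coe n =>
    have : {k : ℕ | (k : ℕ∞) < n} = (Finset.range n : Set ℕ) := by ext; simp
    rw [this, Set.encard_coe_eq_coe_finsetCard, Finset.card_range]

theorem equimeasurable_rearrangement {f : ℕ → ℝ} (hf : Tendsto f atTop (𝓝 0)) :
    Equimeasurable f (rearrangement f) := by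
  intro t ht
  simp only [distribution.eq_1 (rearrangement f), abs_of_nonneg (rearrangement_nonneg f _),
    lt_rearrangement_iff hf ht]
  exact (encard_setOf_natCast_lt _).symm

theorem rearrangement_antitone {f : ℕ → ℝ} (hf : Tendsto f atTop (𝓝 0)) :
    Antitone (rearrangement f) := fun m n h =>
  csInf_le_csInf ⟨0, fun _ h => h.1⟩ (rearrangement_set_nonempty hf m)
    fun _ ht => ⟨ht.1, ht.2.trans (by exact_mod_cast h)⟩

/-- Truncation at `c` keeps the distribution function below `c` and makes it `0` from `c` on. -/
theorem Equimeasurable.min_abs {f g : ℕ → ℝ} (h : Equimeasurable f g) {c : ℝ} (hc : 0 ≤ c) :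
    Equimeasurable (fun n => min |f n| c) (fun n => min |g n| c) := by
  intro t ht
  have key : ∀ f : ℕ → ℝ, distribution (fun n => min |f n| c) t =
      if t < c then distribution f t else 0 := by
    intro f
    simp only [distribution, abs_of_nonneg (le_min (abs_nonneg (f _)) hc), lt_min_iff]
    split_ifs with htc <;> simp [htc]
  rw [key, key, h t ht]

/-! ### Order continuity of `CX` implies that of `X`. -/

theorem le_cesaroOp_of_antitone {f : ℕ → ℝ} (hf : Antitone f) (n : ℕ) : f n ≤ cesaroOp f n := by
  have : ((n : ℝ) + 1) * f n ≤ ∑ k ∈ Finset.range (n + 1), f k := by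
    have := Finset.card_nsmul_le_sum (Finset.range (n + 1)) f (f n)
      fun k hk => hf (Nat.lt_succ_iff.mp (Finset.mem_range.mp hk))
    simpa using this
  rw [cesaroOp, one_div, ← div_eq_inv_mul, le_div_iff₀' (by positivity)]
  exact this

/-- If `CX` is order continuous, then every antitone nonnegative element of `X` is. -/
theorem isOrderContElem_of_antitone {X : NormedIdealSeqSpace} (hw : X.HasWeakUnit)
    (hC : X.CesaroBounded) (h : X.cesaroSpace.IsOrderContinuous) {y : X.carrier}
    (h0 : ∀ n, 0 ≤ (y : ℕ → ℝ) n) (ha : Antitone (y : ℕ → ℝ)) : X.IsOrderContElem y := by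
  have habs : |(y : ℕ → ℝ)| = y := abs_of_nonneg h0
  obtain ⟨M, hM⟩ := hC
  have hmem : (y : ℕ → ℝ) ∈ X.cesaroSpace.carrier := by
    change cesaroOp |(y : ℕ → ℝ)| ∈ X.carrier
    rw [habs]
    exact (hM y).1
  refine (IsOrderContElem.cesaroOp_abs hw ⟨M, hM⟩ (h ⟨_, hmem⟩)).of_abs_le fun n => ?_
  refine le_trans ?_ (le_abs_self _)
  change |(y : ℕ → ℝ)| n ≤ cesaroOp |(y : ℕ → ℝ)| n
  rw [habs]
  exact le_cesaroOp_of_antitone ha n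

theorem equimeasurable_indicator_one {s t : Set ℕ} (h : s.encard = t.encard) :
    Equimeasurable (s.indicator 1) (t.indicator 1) := by
  have key : ∀ (s : Set ℕ) (r : ℝ), 0 ≤ r →
      distribution (s.indicator 1) r = if r < 1 then s.encard else 0 := by
    intro s r hr
    rw [distribution]
    split_ifs with h1
    · congr 1
      ext n
      by_cases hn : n ∈ s <;> simp [hn, h1, hr]
    · rw [Set.encard_eq_zero]
      ext n
      by_cases hn : n ∈ s <;> simp [hn, not_lt.mp h1, hr]
  intro r hr
  rw [key s r hr, key t r hr, h]

/-- Otherwise `X` contains the indicator of an infinite set, hence the constant `1`. Being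
non-increasing, that is order continuous; yet all its tails are equimeasurable, with one nonzero
norm. -/
theorem tendsto_zero_of_mem {X : NormedIdealSeqSpace} (hX : X.IsRearrangementInvariant)
    (hC : X.CesaroBounded) (h : X.cesaroSpace.IsOrderContinuous) (x : X.carrier) :
    Tendsto (x : ℕ → ℝ) atTop (𝓝 0) := by
  by_contra hcon
  have hcon' : ∃ ε > 0, {n : ℕ | ε ≤ |(x : ℕ → ℝ) n|}.Infinite := by
    by_contra! hno
    refine hcon (Metric.tendsto_nhds.mpr fun ε hε => ?_)
    have hfin := hno ε hε
    rw [← Nat.cofinite_eq_atTop, eventually_cofinite]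
    simpa using hfin
  obtain ⟨ε, hε, hinf⟩ := hcon'
  set s := {n : ℕ | ε ≤ |(x : ℕ → ℝ) n|} with hs
  have hmem : s.indicator (1 : ℕ → ℝ) ∈ X.carrier :=
    X.mem_of_abs_le (ε⁻¹ • x) fun n => by
      by_cases hn : n ∈ s
      · have : ε ≤ |(x : ℕ → ℝ) n| := hn
        simp only [hn, Set.indicator_of_mem, Pi.one_apply, abs_one, Submodule.coe_smul,
          Pi.smul_apply, smul_eq_mul, abs_mul, abs_of_pos (inv_pos.mpr hε)]
        rwa [← div_eq_inv_mul, one_le_div hε]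
      · rw [Set.indicator_of_notMem hn, abs_zero]
        exact abs_nonneg _
  have heq : ∀ t : Set ℕ, t.Infinite → Equimeasurable (s.indicator 1) (t.indicator 1) :=
    fun t ht => equimeasurable_indicator_one (by rw [hinf.encard_eq, ht.encard_eq])
  obtain ⟨hone, -⟩ := hX.equimeasurable ⟨_, hmem⟩ _ (heq Set.univ Set.infinite_univ)
  let y : X.carrier := ⟨_, hone⟩
  have hoc : X.IsOrderContElem y := isOrderContElem_of_antitone hX.hasWeakUnit hC h
    (fun n => by simp [y]) (fun m n _ => by simp [y])
  have htail : ∀ N, X.norm (X.tail y N) = X.norm ⟨_, hmem⟩ := by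
    intro N
    obtain ⟨hg, hgn⟩ := hX.equimeasurable ⟨_, hmem⟩ _ (heq (Set.Ici N) (Set.Ici_infinite N))
    rw [← hgn]
    congr 1
    ext n
    simp [tail, y]
  have hlim := hoc.tendsto_tail
  simp only [htail] at hlim
  have hz := X.eq_zero_of_norm_eq_zero _ (tendsto_nhds_unique tendsto_const_nhds hlim)
  obtain ⟨n, hn⟩ := hinf.nonempty
  have := congrFun (congrArg Subtype.val hz) n
  simp [hn] at this

theorem IsOrderContinuous.of_cesaroSpace {X : NormedIdealSeqSpace}
    (hX : X.IsRearrangementInvariant) (hC : X.CesaroBounded)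
    (h : X.cesaroSpace.IsOrderContinuous) : X.IsOrderContinuous := by
  intro x
  have hx := tendsto_zero_of_mem hX hC h x
  have heq := equimeasurable_rearrangement hx
  obtain ⟨hr, -⟩ := hX.equimeasurable x _ heq
  let y : X.carrier := ⟨rearrangement x, hr⟩
  have hy0 : ∀ n, 0 ≤ (y : ℕ → ℝ) n := rearrangement_nonneg _
  have hoc : X.IsOrderContElem y :=
    isOrderContElem_of_antitone hX.hasWeakUnit hC h hy0 (rearrangement_antitone hx)
  let c : ℕ → ℝ := fun m => 1 / ((m : ℝ) + 1)
  have hc : ∀ m, 0 < c m := fun m => Nat.one_div_pos_of_nat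
  have hmin : ∀ (z : X.carrier) (m : ℕ), (fun n => min |(z : ℕ → ℝ) n| (c m)) ∈ X.carrier :=
    fun z m => X.mem_of_abs_le z fun n => by
      rw [abs_of_nonneg (le_min (abs_nonneg _) (hc m).le)]
      exact min_le_left _ _
  have hnn : ∀ m, (0 : X.carrier) ≤ ⟨_, hmin y m⟩ :=
    fun m n => le_min (abs_nonneg _) (hc m).le
  -- The truncations `min y (1/(m+1))` decrease to `0` under the order continuous `y`.
  have hlim := hoc (fun m => ⟨_, hmin y m⟩) hnn (fun m n => min_le_left _ _)
    (fun m n hmn i => min_le_min_left _ (Nat.one_div_le_one_div hmn))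
    (isGLB_of_tendsto_apply hnn fun i => squeeze_zero (fun m => hnn m i)
      (fun m => min_le_right _ _) tendsto_one_div_add_atTop_nhds_zero_nat)
  refine isOrderContElem_of_tail fun ε hε => ?_
  obtain ⟨m, hm⟩ := (hlim.eventually_lt_const hε).exists
  have hev : ∀ᶠ n in atTop, |(x : ℕ → ℝ) n| < c m :=
    hx.abs.eventually_lt_const (by simpa using hc m)
  obtain ⟨N, hN⟩ := eventually_atTop.mp hev
  -- Past `N` the tail of `x` lies below its truncation at `c m`, which has the same norm as the
  -- truncation of `y`.
  obtain ⟨hg, hgn⟩ := hX.equimeasurable ⟨_, hmin x m⟩ _ (heq.min_abs (hc m).le)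
  refine ⟨N, ?_⟩
  calc X.norm (X.tail x N) ≤ X.norm ⟨_, hmin x m⟩ := by
        refine X.norm_le_of_abs_le _ _ fun i => ?_
        rw [coe_tail]
        refine le_trans ?_ (le_abs_self _)
        split_ifs with hi
        · exact le_min le_rfl (hN i hi).le
        · simpa using (hc m).le
    _ = X.norm ⟨_, hg⟩ := hgn.symm
    _ ≤ ε := hm.le

end NormedIdealSeqSpace

theorem mainTheorem9 (X : NormedIdealSeqSpace)
    (hX : X.IsRearrangementInvariant) (hC : X.CesaroBounded) :
    X.cesaroSpace.orderContPart = X.orderContPart.cesaroSpace ∧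
      (X.cesaroSpace.IsOrderContinuous ↔ X.IsOrderContinuous) :=
  ⟨NormedIdealSeqSpace.orderContPart_cesaroSpace hX.hasWeakUnit hC,
    fun h => h.of_cesaroSpace hX hC, fun h => h.cesaroSpace⟩
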